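/- For each integer $m\ge 1$ define $F_1,G_1:\mathbb{Z}^{m+1}\to\mathbb{Z}$ by $$F_1(N_0,\dots,N_m)=N_m+2\sum_{k=1}^{m}N_{m-k},\qquad G_1(N_0,\dots,N_m)=-mN_m+2\sum_{k=1}^{m}(6k^2-m)N_{m-k},$$ and let $$\mathcal{Z}_1=\{(N_0,\dots,N_m)\in(\mathbb{Z}_{\ge 0})^{m+1} : F_1(N_0,\dots,N_m)>0,\ G_1(N_0,\dots,N_m)=0\}.$$ Let $n=2m$ be an even positive integer. Then the minimum $\mathcal{B}(n)$ of $F_1$ on $\mathcal{Z}_1$ exists, and with $r=\gcd(m,12)$ it is given as follows. For a positive integer $a$, let $E(a)$ denote the condition that every prime factor of $a$ congruent to $3$ modulo $4$ occurs in $a$ with even exponent. (i) If $r=1$, then $\mathcal{B}(n)=12$. (ii) If $r=2$, then $\mathcal{B}(n)=6$ if $n\not\equiv 28\pmod{32}$, and $\mathcal{B}(n)=12$ otherwise. (iii) If $r=3$, then $\mathcal{B}(n)=4$ if $E(n/6)$ holds, and $\mathcal{B}(n)=8$ otherwise. (iv) If $r=4$, then $\mathcal{B}(n)=3$ if $n/2$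 is a square; $\mathcal{B}(n)=6$ if $n/2$ is not a square and $n\ne 4^k(8t+7)$ for all integers $k,t\ge 0$; and $\mathcal{B}(n)=9$ otherwise. (v) If $r=6$, then $\mathcal{B}(n)=2$ if $n/12$ is a square; $\mathcal{B}(n)=4$ if $n/12$ is not a square and $E(n/6)$ holds; $\mathcal{B}(n)=6$ if $n/12$ is not a square, $E(n/6)$ fails and $n\not\equiv 28\pmod{32}$; and $\mathcal{B}(n)=8$ otherwise. (vi) If $r=12$, then $\mathcal{B}(n)=2$ if $n/12$ is a square; $\mathcal{B}(n)=3$ if $n/2$ is a square; $\mathcal{B}(n)=4$ if neither $n/12$ nor $n/2$ is a square and $E(n/6)$ holds; $\mathcal{B}(n)=6$ if none of the above holds and $n\neq 4^k(8t+7)$ for all integers $k,t\ge 0$; and $\mathcal{B}(n)=7$ otherwise. Moreover, the set of values taken by $\mathcal{B}(n)$, as $n$ runs over the even positive integers, is exactly $\{2,3,4,6,7,8,9,12\}$. -/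

import Mathlib

/-- The function `F₁(N₀, …, N_m) = N_m + 2 ∑_{k=1}^m N_{m-k}` on `ℤ^{m+1}`. -/
def F₁ (m : ℕ) (N : Fin (m + 1) → ℤ) : ℤ :=
  N (Fin.last m) + 2 * ∑ k ∈ Finset.Icc 1 m, N ⟨m - k, by omega⟩

/-- The function `G₁(N₀, …, N_m) = -m N_m + 2 ∑_{k=1}^m (6k² - m) N_{m-k}` on `ℤ^{m+1}`. -/
def G₁ (m : ℕ) (N : Fin (m + 1) → ℤ) : ℤ :=
  -(m : ℤ) * N (Fin.last m)
    + 2 * ∑ k ∈ Finset.Icc 1 m, (6 * (k : ℤ) ^ 2 - (m : ℤ)) * N ⟨m - k, by omega⟩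

/-- The set `𝒵₁` of vectors with nonnegative integer entries, `F₁ > 0` and `G₁ = 0`. -/
def Z₁ (m : ℕ) : Set (Fin (m + 1) → ℤ) :=
  {N | (∀ i, 0 ≤ N i) ∧ 0 < F₁ m N ∧ G₁ m N = 0}

/-- `ℬ(n)` for even `n = 2m`: the minimum of `F₁` on `𝒵₁`, as an infimum in `ℤ`.
(The theorem also asserts that this infimum is attained.) -/
noncomputable def calB (n : ℕ) : ℤ :=
  sInf (F₁ (n / 2) '' Z₁ (n / 2))

/-- Every prime factor of `a` congruent to `3` modulo `4` occurs in `a` with even exponent. -/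
def EvenExponents (a : ℕ) : Prop :=
  ∀ p : ℕ, p.Prime → p ∣ a → p ≡ 3 [MOD 4] → Even (a.factorization p)

/-- `a` has the form `4^k (8t + 7)` with `k, t` nonnegative integers. -/
def IsFourPowForm (a : ℕ) : Prop :=
  ∃ k t : ℕ, a = 4 ^ k * (8 * t + 7)

/-!
A vector `N ∈ 𝒵₁` with `F₁ m N = S` describes `S` integer points: `N_m` copies of `0`, and for
`1 ≤ k ≤ m` the pair `±k` with multiplicity `N_{m-k}`. The equation `G₁ m N = 0` says that six
times the sum of the squares of these points is `m S`. Keeping one point of each pair, and joining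
the zeros in pairs, one finds (`exists_list_of_mem_image`, `mem_image_of_list`) that `S ≤ 12` is a
value of `F₁` on `𝒵₁` if and only if `0 < S`, `12 ∣ m S`, and `m S / 12` is a sum of `⌊S / 2⌋`
squares. The bound `k ≤ m` costs nothing, as `k² ≤ m S / 12 ≤ m`.

So `S = 1` never occurs, and the values `S = 2, 3`, `S = 4, 5`, `S = 6, 7`, `8 ≤ S ≤ 12` are
governed by sums of one, two, three, four squares. The case distinction on `gcd m 12` says which
`S` satisfy `12 ∣ m S`. Two coincidences occur when `m = 12 u`: `S = 5` is never the minimum, since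
`5 u` and `4 u` are sums of two squares simultaneously (`EvenExponents.four_mul_of_five_mul`), and
if `6 u` is of the form `4 ^ k (8 t + 7)` then `7 u` is not (`not_isFourPowForm_seven_mul`).

Sums of two and of four squares are in Mathlib. Legendre's theorem on three squares,
`exists_three_squares_iff`, is proved here after Dirichlet: a positive definite integral ternary
form of determinant `1` is a sum of three squares of integral linear forms, which follows by
reduction (`ternary_form_eq_sum_three_squares`). A form of this kind that represents `n` exists as
soon as `-d` is a square modulo `d n - 1` for some `d > 0`. A suitable `d`, for which `d n - 1` is
a prime or twice a prime, comes from Dirichlet's theorem on primes in arithmetic progressions and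
quadratic reciprocity.
-/

/-! ### Reduction of unimodular forms in two and three variables -/

theorem exists_shift_two_mul_abs_le {a : ℤ} (ha : 0 < a) (b : ℤ) :
    ∃ t : ℤ, 2 * |b + t * a| ≤ a := by
  have h1 := Int.emod_nonneg b ha.ne'
  have h2 := Int.emod_lt_of_pos b ha
  have h3 := Int.emod_add_mul_ediv b a
  rcases le_total (2 * (b % a)) a with h | h
  · refine ⟨-(b / a), ?_⟩
    have : b + -(b / a) * a = b % a := by linarith
    rw [this, abs_of_nonneg h1]
    exact h
  · refine ⟨-(b / a) - 1, ?_⟩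
    have : b + (-(b / a) - 1) * a = b % a - a := by linarith
    rw [this, abs_of_nonpos (by linarith)]
    linarith

theorem four_mul_sq_le_of_two_mul_abs_le {a b : ℤ} (h : 2 * |b| ≤ a) : 4 * b ^ 2 ≤ a ^ 2 := by
  have h0 := abs_nonneg b
  rw [← sq_abs b]
  nlinarith

/-- A positive definite binary form of determinant `1` takes only sums of two squares as values. The
proof is a descent on the leading coefficient `a ≤ k`: after a shift that makes `2 |b| ≤ a`, either
`d < a` and the variables are exchanged, or `a² ≤ a d = 1 + b² ≤ 1 + a² / 4`, whence `a = 1`. -/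
theorem binary_form_eq_sum_two_squares (k : ℕ) : ∀ a b d : ℤ, a.toNat ≤ k → 0 < a →
    a * d - b ^ 2 = 1 → ∀ x y : ℤ, ∃ u v : ℤ,
      a * x ^ 2 + 2 * b * x * y + d * y ^ 2 = u ^ 2 + v ^ 2 := by
  induction k with
  | zero => intro a b d h ha; omega
  | succ k ih =>
    intro a b d hk ha hdet x y
    obtain ⟨t, ht⟩ := exists_shift_two_mul_abs_le ha b
    have hsq := four_mul_sq_le_of_two_mul_abs_le ht
    set b' := b + t * a with hb'
    set d' := d + 2 * t * b + t ^ 2 * a with hd'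
    have hdet' : a * d' - b' ^ 2 = 1 := by rw [← hdet, hb', hd']; ring
    rcases lt_or_ge d' a with hlt | hge
    · have hdpos : 0 < d' := by
        have : 0 < a * d' := by nlinarith [sq_nonneg b']
        exact pos_of_mul_pos_right this ha.le
      obtain ⟨u, v, h⟩ := ih d' b' a (by omega) hdpos (by linarith) y (x - t * y)
      refine ⟨u, v, ?_⟩
      rw [← h, hb', hd']; ring
    · have ha1 : a = 1 := by nlinarith
      refine ⟨x + b * y, y, ?_⟩
      subst ha1
      linear_combination y ^ 2 * hdet

/-- The bounds satisfied by the leading minors of a reduced ternary form of determinant `1` force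
the first coefficient to be `1`. -/
theorem eq_one_of_hermite_bounds {a A : ℤ} (ha : 0 < a) (hA : 0 < A)
    (h₁ : 3 * (a * a) ≤ 4 * A) (h₂ : 3 * (A * A) ≤ 4 * a) : a = 1 := by
  rcases le_total a A with h | h
  · have : A < 2 := by nlinarith
    omega
  · have : a < 2 := by nlinarith
    omega

/-- A positive definite ternary form of determinant `1` takes only sums of three squares as values.
The proof is a lexicographic descent on the leading minors `a ≤ k` and `A = a d - b² ≤ l`.
Completing the square, `a` times the form is `(a x + b y + c z)² + g(y, z)`, where `g` is a binary
form with leading coefficient `A` and determinant `a`. Reducing `g` by a change of `y` and `z`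
makes `A` smaller without altering `a`, until `3 A² ≤ 4 a`. Then the binary form in `x` and `y`, of
determinant `A`, is reduced, which makes `a` smaller unless `3 a² ≤ 4 A`. In the end `a = 1`, and
`g` is a binary form of determinant `1`. -/
theorem ternary_form_eq_sum_three_squares (k : ℕ) : ∀ l : ℕ, ∀ a b c d e f : ℤ,
    a.toNat ≤ k → (a * d - b ^ 2).toNat ≤ l → 0 < a → 0 < a * d - b ^ 2 →
    a * d * f + 2 * b * c * e - a * e ^ 2 - d * c ^ 2 - f * b ^ 2 = 1 →
    ∀ x y z : ℤ, ∃ u v w : ℤ,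
      a * x ^ 2 + d * y ^ 2 + f * z ^ 2 + 2 * b * x * y + 2 * c * x * z + 2 * e * y * z
        = u ^ 2 + v ^ 2 + w ^ 2 := by
  induction k with
  | zero => intro l a b c d e f h _ ha; omega
  | succ k ihk =>
    intro l
    induction l with
    | zero => intro a b c d e f _ h _ hA; omega
    | succ l ihl =>
      intro a b c d e f hk hl ha hA hdet x y z
      -- The shift `y ↦ y + s z` adds `s A` to the middle coefficient `a e - b c` of `g`.
      obtain ⟨s, hs⟩ := exists_shift_two_mul_abs_le hA (a * e - b * c)
      have hsq := four_mul_sq_le_of_two_mul_abs_le hs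
      set c' := c + s * b with hc'
      set e' := e + s * d with he'
      set f' := f + 2 * s * e + s ^ 2 * d with hf'
      have hB : a * e - b * c + s * (a * d - b ^ 2) = a * e' - b * c' := by
        rw [hc', he']; ring
      rw [hB] at hsq
      have hdet' : a * d * f' + 2 * b * c' * e' - a * e' ^ 2 - d * c' ^ 2 - f' * b ^ 2 = 1 := by
        rw [← hdet, hc', he', hf']; ring
      have hdisc : (a * d - b ^ 2) * (a * f' - c' ^ 2) = a + (a * e' - b * c') ^ 2 := by
        linear_combination a * hdet'
      rcases lt_or_ge (a * f' - c' ^ 2) (a * d - b ^ 2) with hlt | hge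
      · have hC : 0 < a * f' - c' ^ 2 := by
          refine pos_of_mul_pos_right (a := a * d - b ^ 2) ?_ hA.le
          rw [hdisc]; positivity
        obtain ⟨u, v, w, h⟩ := ihl a c' b f' e' d hk (by omega) ha hC
          (by linarith) x z (y - s * z)
        refine ⟨u, v, w, ?_⟩
        rw [← h, hc', he', hf']; ring
      · obtain ⟨t, ht⟩ := exists_shift_two_mul_abs_le ha b
        have hsqb := four_mul_sq_le_of_two_mul_abs_le ht
        set b' := b + t * a with hb'
        set d' := d + 2 * t * b + t ^ 2 * a with hd'
        have hA' : a * d' - b' ^ 2 = a * d - b ^ 2 := by rw [hb', hd']; ring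
        rcases lt_or_ge d' a with hlt | hge'
        · have hdpos : 0 < d' := by
            refine pos_of_mul_pos_right (a := a) ?_ ha.le
            nlinarith [sq_nonneg b']
          obtain ⟨u, v, w, h⟩ := ihk _ d' b' (e + t * c) a c f (by omega) le_rfl hdpos
            (by linarith) (by rw [← hdet, hb', hd']; ring) y (x - t * y) z
          refine ⟨u, v, w, ?_⟩
          rw [← h, hb', hd']; ring
        · have ha1 : a = 1 := by
            have hmul := mul_le_mul_of_nonneg_left hge' ha.le
            have hmul' := mul_le_mul_of_nonneg_left hge hA.le
            exact eq_one_of_hermite_bounds ha hA (by linarith) (by linarith)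
          subst ha1
          obtain ⟨u, v, h⟩ := binary_form_eq_sum_two_squares _ (1 * d - b ^ 2) (1 * e - b * c)
            (1 * f - c ^ 2) le_rfl hA (by linear_combination hdet) y z
          refine ⟨x + b * y + c * z, u, v, ?_⟩
          linear_combination h

/-! ### Legendre's three-square theorem -/

/-- With `q (d n - 1) = x² + d`, the form with matrix `!![q, x, 1; x, d n - 1, 0; 1, 0, n]` has
leading minors `q`, `d` and `1`, and it takes the value `n` at `(0, 0, 1)`. -/
theorem exists_three_squares_of_sq_add_dvd {n d x : ℤ} (hd : 0 < d) (hn : 0 < d * n - 1)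
    (h : d * n - 1 ∣ x ^ 2 + d) : ∃ u v w : ℤ, n = u ^ 2 + v ^ 2 + w ^ 2 := by
  obtain ⟨q, hq⟩ := h
  have hqpos : 0 < q := by
    refine pos_of_mul_pos_right (a := d * n - 1) ?_ hn.le
    rw [← hq]; positivity
  obtain ⟨u, v, w, h⟩ := ternary_form_eq_sum_three_squares _ _ q x 1 (d * n - 1) 0 n le_rfl le_rfl
    hqpos (by linarith) (by linear_combination (-n) * hq) 0 0 1
  exact ⟨u, v, w, by rw [← h]; ring⟩

theorem exists_three_squares_of_prime {n d p : ℕ} (hd : 0 < d) (hp : p.Prime)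
    (h : d * n = p + 1) (hJ : jacobiSym (-d) p = 1) :
    ∃ u v w : ℤ, (n : ℤ) = u ^ 2 + v ^ 2 + w ^ 2 := by
  have := Fact.mk hp
  obtain ⟨y, hy⟩ := ZMod.isSquare_of_jacobiSym_eq_one hJ
  have hz : (d : ℤ) * n = p + 1 := by exact_mod_cast h
  have hp0 := hp.pos
  refine exists_three_squares_of_sq_add_dvd (d := d) (x := y.val) (by omega) (by omega) ?_
  rw [hz, add_sub_cancel_right, ← ZMod.intCast_zmod_eq_zero_iff_dvd]
  push_cast at hy ⊢
  rw [ZMod.natCast_zmod_val, sq, ← hy]; ring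

theorem exists_three_squares_of_two_mul_prime {n d p : ℕ} (hd : Odd d) (hp : p.Prime)
    (hp2 : Odd p) (h : d * n = 2 * p + 1) (hJ : jacobiSym (-d) p = 1) :
    ∃ u v w : ℤ, (n : ℤ) = u ^ 2 + v ^ 2 + w ^ 2 := by
  have := Fact.mk hp
  obtain ⟨y, hy⟩ := ZMod.isSquare_of_jacobiSym_eq_one hJ
  have hz : (d : ℤ) * n = 2 * p + 1 := by exact_mod_cast h
  have hp0 := hp.pos
  -- An odd root makes `x ^ 2 + d` divisible by `2` as well as by `p`.
  obtain ⟨x, hx, hxy⟩ : ∃ x : ℤ, Odd x ∧ (x : ZMod p) = y := by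
    rcases Nat.even_or_odd y.val with he | ho
    · exact ⟨y.val + p, by exact_mod_cast he.add_odd hp2, by simp⟩
    · exact ⟨y.val, by exact_mod_cast ho, by simp⟩
  refine exists_three_squares_of_sq_add_dvd (d := d) (x := x) (by have := hd.pos; omega)
    (by omega) ?_
  rw [hz, add_sub_cancel_right]
  refine IsCoprime.mul_dvd ?_ ?_ ?_
  · have : Nat.Coprime 2 p := hp2.coprime_two_left
    exact_mod_cast Nat.isCoprime_iff_coprime.mpr this
  · have hd' : Odd (d : ℤ) := by exact_mod_cast hd
    exact (hx.pow.add_odd hd').two_dvd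
  · rw [← ZMod.intCast_zmod_eq_zero_iff_dvd]
    push_cast at hy ⊢
    rw [hxy, sq, ← hy]; ring

/-- The prime is `p = d n - 1` with `d = 4 j + 1`, so that `p ≡ 1 [MOD 4]` and reciprocity gives
`(-d / p) = (p / d) = (-1 / d) = 1`. -/
theorem exists_three_squares_of_mod_four_eq_two {n : ℕ} (hn : n % 4 = 2) :
    ∃ u v w : ℤ, (n : ℤ) = u ^ 2 + v ^ 2 + w ^ 2 := by
  have hcop : (n - 1).Coprime (4 * n) := by
    refine Nat.Coprime.mul_right ?_ ?_
    · exact Nat.Coprime.pow_right 2 (Nat.odd_iff.mpr (by omega) : Odd (n - 1)).coprime_two_right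
    · exact (Nat.coprime_self_sub_left (by omega)).mpr (Nat.coprime_one_left n)
  obtain ⟨p, hpn, hp, hmod⟩ := Nat.forall_exists_prime_gt_and_modEq n (by omega) hcop
  obtain ⟨j, hj⟩ := (Nat.modEq_iff_dvd' (by omega)).mp hmod.symm
  have hpj : (4 * j + 1) * n = p + 1 := by
    have : (4 * j + 1) * n = 4 * n * j + n := by ring
    omega
  refine exists_three_squares_of_prime (Nat.succ_pos _) hp hpj ?_
  have hp4 : p % 4 = 1 := by
    have : 4 * n * j = 4 * (n * j) := by ring
    omega
  have hodd : Odd (4 * j + 1) := Nat.odd_iff.mpr (by omega)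
  rw [jacobiSym.neg _ (Nat.odd_iff.mpr (by omega)), ZMod.χ₄_nat_one_mod_four hp4, one_mul,
    jacobiSym.quadratic_reciprocity_one_mod_four (by omega) (Nat.odd_iff.mpr (by omega)),
    jacobiSym.mod_left' (a₂ := -1), jacobiSym.at_neg_one hodd, ZMod.χ₄_nat_one_mod_four (by omega)]
  apply Int.ModEq.symm
  rw [Int.modEq_iff_dvd]
  exact ⟨n, by rw [sub_neg_eq_add]; exact_mod_cast hpj.symm⟩

/-- The prime is `p = (d n - 1) / 2` with `d = 8 j + c`. The choice of `c` makes `(c n - 1) / 2`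
odd, and it makes `(-d / p) = (p / d)` and `(-2 / d) = 1`; as `-2 p ≡ 1` modulo `d`, the symbol is
`1`. -/
theorem exists_three_squares_of_odd {n c : ℕ} (hc : c = 1 ∧ n % 8 = 3 ∨ c = 3 ∧ n % 4 = 1)
    (hn1 : 1 < n) : ∃ u v w : ℤ, (n : ℤ) = u ^ 2 + v ^ 2 + w ^ 2 := by
  obtain ⟨q, hq⟩ : ∃ q, c * n = 2 * q + 1 :=
    ⟨c * n / 2, by rcases hc with ⟨rfl, h⟩ | ⟨rfl, h⟩ <;> omega⟩
  have hqodd : q % 2 = 1 := by rcases hc with ⟨rfl, h⟩ | ⟨rfl, h⟩ <;> omega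
  have hq4 : c = 3 ∨ q % 4 = 1 := by
    rcases hc with ⟨rfl, h⟩ | ⟨rfl, h⟩
    · right; omega
    · exact Or.inl rfl
  have hcop : q.Coprime (4 * n) := by
    refine Nat.Coprime.mul_right ?_ ?_
    · exact Nat.Coprime.pow_right 2 (Nat.odd_iff.mpr hqodd).coprime_two_right
    · rw [← Nat.isCoprime_iff_coprime]
      exact ⟨-2, c, by have : (c : ℤ) * n = 2 * q + 1 := by exact_mod_cast hq
                       linarith⟩
  obtain ⟨p, hpn, hp, hmod⟩ := Nat.forall_exists_prime_gt_and_modEq (q + 2) (by omega) hcop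
  obtain ⟨j, hj⟩ := (Nat.modEq_iff_dvd' (by omega)).mp hmod.symm
  have hpj : (8 * j + c) * n = 2 * p + 1 := by
    have : (8 * j + c) * n = 2 * (4 * n * j) + c * n := by ring
    omega
  have hp4 : p % 4 = q % 4 := by
    have : 4 * n * j = 4 * (n * j) := by ring
    omega
  have hpodd : Odd p := Nat.odd_iff.mpr (by omega)
  have hdodd : Odd (8 * j + c) := Nat.odd_iff.mpr (by omega)
  refine exists_three_squares_of_two_mul_prime hdodd hp hpodd hpj ?_
  have hrec : jacobiSym (-(8 * j + c : ℕ)) p = jacobiSym p (8 * j + c) := by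
    rw [jacobiSym.neg _ hpodd]
    rcases Nat.odd_mod_four_iff.mp (Nat.odd_iff.mp hpodd) with h | h
    · rw [ZMod.χ₄_nat_one_mod_four h, one_mul,
        jacobiSym.quadratic_reciprocity_one_mod_four' hdodd h]
    · rw [ZMod.χ₄_nat_three_mod_four h,
        jacobiSym.quadratic_reciprocity_three_mod_four (by omega) h, neg_one_mul, neg_neg]
  have hneg2 : jacobiSym (-2) (8 * j + c) = 1 := by
    rw [jacobiSym.at_neg_two hdodd, ZMod.χ₈'_nat_eq_if_mod_eight]
    rw [if_neg (by omega), if_pos (by omega)]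
  have hprod : jacobiSym (-2 * p) (8 * j + c) = 1 := by
    rw [jacobiSym.mod_left' (a₂ := 1), jacobiSym.one_left]
    apply Int.ModEq.symm
    rw [Int.modEq_iff_dvd]
    exact ⟨-n, by have : ((8 * j + c : ℕ) : ℤ) * n = 2 * p + 1 := by exact_mod_cast hpj
                  linarith⟩
  rw [hrec, ← hprod, jacobiSym.mul_left, hneg2, one_mul]

theorem exists_three_squares_of_not_isFourPowForm (n : ℕ) (h : ¬ IsFourPowForm n) :
    ∃ x y z : ℕ, x ^ 2 + y ^ 2 + z ^ 2 = n := by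
  induction n using Nat.strong_induction_on with
  | _ n ih =>
    rcases Nat.lt_or_ge 1 n with hn1 | hn1
    · by_cases h4 : n % 4 = 0
      · obtain ⟨x, y, z, hxyz⟩ := ih (n / 4) (by omega) (by
          rintro ⟨k, t, hk⟩
          exact h ⟨k + 1, t, by rw [pow_succ, mul_right_comm, ← hk]; omega⟩)
        refine ⟨2 * x, 2 * y, 2 * z, ?_⟩
        have : (2 * x) ^ 2 + (2 * y) ^ 2 + (2 * z) ^ 2 = 4 * (x ^ 2 + y ^ 2 + z ^ 2) := by ring
        omega
      · obtain ⟨u, v, w, huvw⟩ : ∃ u v w : ℤ, (n : ℤ) = u ^ 2 + v ^ 2 + w ^ 2 := by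
          have h7 : n % 8 ≠ 7 := fun h7 => h ⟨0, n / 8, by omega⟩
          have hcases : n % 4 = 2 ∨ n % 8 = 3 ∨ n % 4 = 1 := by omega
          rcases hcases with h2 | h3 | h1
          · exact exists_three_squares_of_mod_four_eq_two h2
          · exact exists_three_squares_of_odd (c := 1) (Or.inl ⟨rfl, h3⟩) hn1
          · exact exists_three_squares_of_odd (c := 3) (Or.inr ⟨rfl, h1⟩) hn1
        refine ⟨u.natAbs, v.natAbs, w.natAbs, ?_⟩
        zify
        simp only [sq_abs]
        exact huvw.symm
    · interval_cases n
      · exact ⟨0, 0, 0, rfl⟩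
      · exact ⟨1, 0, 0, rfl⟩

theorem sq_add_sq_add_sq_mod_eight_ne_seven (x y z : ℕ) :
    (x ^ 2 + y ^ 2 + z ^ 2) % 8 ≠ 7 := by
  have h (a : ℕ) : a ^ 2 % 8 = 0 ∨ a ^ 2 % 8 = 1 ∨ a ^ 2 % 8 = 4 := by
    have : a % 8 < 8 := Nat.mod_lt _ (by norm_num)
    rw [Nat.pow_mod]
    interval_cases a % 8 <;> simp
  have := h x
  have := h y
  have := h z
  omega

theorem two_dvd_of_four_dvd_sum_three_squares {x y z : ℕ} (h : 4 ∣ x ^ 2 + y ^ 2 + z ^ 2) :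
    2 ∣ x ∧ 2 ∣ y ∧ 2 ∣ z := by
  have hsq (a : ℕ) : a % 2 = 0 ∧ a ^ 2 % 4 = 0 ∨ a % 2 = 1 ∧ a ^ 2 % 4 = 1 := by
    have : a % 4 < 4 := Nat.mod_lt _ (by norm_num)
    rw [← Nat.mod_mod_of_dvd a (by norm_num : 2 ∣ 4), Nat.pow_mod]
    interval_cases a % 4 <;> simp
  have := hsq x
  have := hsq y
  have := hsq z
  omega

/-- **Legendre's three-square theorem**. -/
theorem exists_three_squares_iff {n : ℕ} :
    (∃ x y z : ℕ, x ^ 2 + y ^ 2 + z ^ 2 = n) ↔ ¬ IsFourPowForm n := by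
  refine ⟨?_, exists_three_squares_of_not_isFourPowForm n⟩
  rintro ⟨x, y, z, h⟩ ⟨k, t, rfl⟩
  induction k generalizing x y z with
  | zero => exact sq_add_sq_add_sq_mod_eight_ne_seven x y z (by omega)
  | succ k ih =>
    obtain ⟨⟨a, rfl⟩, ⟨b, rfl⟩, ⟨c, rfl⟩⟩ :=
      two_dvd_of_four_dvd_sum_three_squares (x := x) (y := y) (z := z)
        (h ▸ (dvd_pow_self 4 k.succ_ne_zero).mul_right _)
    refine ih a b c (Nat.eq_of_mul_eq_mul_left (by norm_num : 0 < 4) ?_)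
    rw [pow_succ' 4 k, mul_assoc] at h
    rw [← h]
    ring

/-! ### Values of `F₁` on `𝒵₁` and sums of squares -/

/-- The multiset that contains `k` with multiplicity `N_{m-k}` for `1 ≤ k ≤ m`; a negative `N_{m-k}`
counts as `0`. -/
def multisetOfVector (m : ℕ) (N : Fin (m + 1) → ℤ) : Multiset ℕ :=
  ∑ k ∈ Finset.Icc 1 m, Multiset.replicate (N ⟨m - k, by omega⟩).toNat k

/-- One point of each pair `±k` is kept, and the list is filled up with zeros to the length
`S / 2`. -/
theorem exists_list_of_mem_image {m S : ℕ} (h : (S : ℤ) ∈ F₁ m '' Z₁ m) :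
    0 < S ∧ ∃ l : List ℕ, l.length = S / 2 ∧ 12 * (l.map (· ^ 2)).sum = m * S := by
  obtain ⟨N, ⟨hN, hF, hG⟩, hS⟩ := h
  refine ⟨by omega, ?_⟩
  set M := multisetOfVector m N with hM
  have hcard : (M.card : ℤ) = ∑ k ∈ Finset.Icc 1 m, N ⟨m - k, by omega⟩ := by
    rw [hM, multisetOfVector, Multiset.card_sum, Nat.cast_sum]
    refine Finset.sum_congr rfl fun k _ => ?_
    rw [Multiset.card_replicate, Int.toNat_of_nonneg (hN _)]
  have hsum : (((M.map (· ^ 2)).sum : ℕ) : ℤ) =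
      ∑ k ∈ Finset.Icc 1 m, (k : ℤ) ^ 2 * N ⟨m - k, by omega⟩ := by
    rw [hM, multisetOfVector, ← Multiset.coe_mapAddMonoidHom, map_sum,
      Multiset.sum_sum, Nat.cast_sum]
    refine Finset.sum_congr rfl fun k _ => ?_
    rw [Multiset.coe_mapAddMonoidHom, Multiset.map_replicate, Multiset.sum_replicate, smul_eq_mul,
      Nat.cast_mul, Int.toNat_of_nonneg (hN _), Nat.cast_pow, mul_comm]
  have hlast := hN (Fin.last m)
  rw [F₁, ← hcard] at hS
  have hG' : G₁ m N = 12 * (((M.map (· ^ 2)).sum : ℕ) : ℤ) - m * S := by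
    rw [G₁, ← hS, hcard, hsum]
    simp only [sub_mul, Finset.sum_sub_distrib, mul_assoc, ← Finset.mul_sum]
    ring
  refine ⟨M.toList ++ List.replicate (S / 2 - M.card) 0, ?_, ?_⟩
  · rw [List.length_append, List.length_replicate, Multiset.length_toList]
    omega
  · have hl : ((M.toList ++ List.replicate (S / 2 - M.card) 0).map (· ^ 2)).sum
        = (M.map (· ^ 2)).sum := by
      rw [List.map_append, List.sum_append, List.map_replicate, List.sum_replicate]
      conv_rhs => rw [← M.coe_toList, Multiset.map_coe, Multiset.sum_coe]
      simp
    rw [hl]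
    have h12 : 12 * (((M.map (· ^ 2)).sum : ℕ) : ℤ) = m * S := by linarith
    exact_mod_cast h12

/-- A sum over a list of naturals at most `m`, grouped by the value of the entries, with the zeros
set apart. -/
theorem sum_map_eq_sum_Icc_count {m : ℕ} {l : List ℕ} (hle : ∀ a ∈ l, a ≤ m) (f : ℕ → ℕ) :
    (l.map f).sum = ∑ k ∈ Finset.Icc 1 m, l.count k * f k + l.count 0 * f 0 := by
  rw [Finset.sum_list_map_count, add_comm]
  have hIcc : Finset.Ico 1 (m + 1) = Finset.Icc 1 m := rfl
  rw [← hIcc, ← Finset.sum_range_eq_add_Ico (fun k => l.count k * f k) m.succ_pos]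
  refine Finset.sum_subset (fun a ha => ?_) fun a _ ha => ?_
  · rw [Finset.mem_range]
    exact Nat.lt_succ_of_le (hle a (List.mem_toFinset.mp ha))
  · rw [List.count_eq_zero_of_not_mem fun h => ha (List.mem_toFinset.mpr h), zero_smul]

/-- The bound `S ≤ 12` guarantees that the entries of the list are at most `m`. -/
theorem mem_image_of_list {m S : ℕ} (hS : 0 < S) (hS12 : S ≤ 12) {l : List ℕ}
    (hlen : l.length = S / 2) (hsum : 12 * (l.map (· ^ 2)).sum = m * S) :
    (S : ℤ) ∈ F₁ m '' Z₁ m := by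
  have hle : ∀ a ∈ l, a ≤ m := by
    intro a ha
    have h1 : a ^ 2 ≤ (l.map (· ^ 2)).sum :=
      List.single_le_sum (by simp) _ (List.mem_map_of_mem ha)
    have h2 : m * S ≤ m * 12 := Nat.mul_le_mul_left m hS12
    nlinarith
  have hcard : ∑ k ∈ Finset.Icc 1 m, l.count k + l.count 0 = l.length := by
    simpa using (sum_map_eq_sum_Icc_count hle fun _ => 1).symm
  have hsq : ∑ k ∈ Finset.Icc 1 m, k ^ 2 * l.count k = (l.map (· ^ 2)).sum := by
    rw [sum_map_eq_sum_Icc_count hle, zero_pow two_ne_zero, mul_zero, add_zero]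
    exact Finset.sum_congr rfl fun k _ => mul_comm _ _
  have hcardZ : ∑ k ∈ Finset.Icc 1 m, (l.count k : ℤ) = l.length - l.count 0 := by
    rw [← hcard]; push_cast; ring
  have hsqZ : ∑ k ∈ Finset.Icc 1 m, (k : ℤ) ^ 2 * l.count k = ((l.map (· ^ 2)).sum : ℕ) := by
    rw [← hsq]; push_cast; ring
  -- The points that are not a nonzero entry of the list or its negative are zeros: two for each
  -- zero of the list, and one more if `S` is odd.
  let N : Fin (m + 1) → ℤ := fun i =>
    if i = Fin.last m then S - 2 * (l.length - l.count 0) else l.count (m - i)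
  have hNlast : N (Fin.last m) = S - 2 * (l.length - l.count 0) := if_pos rfl
  have hNk : ∀ k ∈ Finset.Icc 1 m, N ⟨m - k, by omega⟩ = l.count k := by
    intro k hk
    rw [Finset.mem_Icc] at hk
    have h1 : (⟨m - k, by omega⟩ : Fin (m + 1)) ≠ Fin.last m := by
      rw [Ne, Fin.ext_iff, Fin.val_last, Fin.val_mk]; omega
    simp only [N, if_neg h1]
    congr 2
    omega
  have hF : F₁ m N = S := by
    rw [F₁, hNlast, Finset.sum_congr rfl hNk, hcardZ]; ring
  refine ⟨N, ⟨fun i => ?_, by rw [hF]; exact_mod_cast hS, ?_⟩, hF⟩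
  · by_cases h : i = Fin.last m
    · rw [h, hNlast]; omega
    · simp only [N, if_neg h]; positivity
  · rw [G₁, hNlast, Finset.sum_congr rfl fun k hk => by rw [hNk k hk]]
    simp only [sub_mul, Finset.sum_sub_distrib, mul_assoc, ← Finset.mul_sum]
    rw [hcardZ, hsqZ]
    zify at hsum
    linarith

/-! ### Sums of one to four squares -/

theorem dvd_of_mem_image {m S : ℕ} (h : (S : ℤ) ∈ F₁ m '' Z₁ m) : 12 ∣ m * S := by
  obtain ⟨_, l, _, h⟩ := exists_list_of_mem_image h
  exact ⟨_, h.symm⟩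

theorem one_notMem_image {m : ℕ} (hm : 0 < m) : ((1 : ℕ) : ℤ) ∉ F₁ m '' Z₁ m := by
  intro h
  obtain ⟨_, l, hl, h⟩ := exists_list_of_mem_image h
  rw [List.length_eq_zero_iff.mp hl] at h
  simp at h
  omega

/-- The values `S = 2` and `S = 3`. -/
theorem mem_image_iff_isSquare {m S t : ℕ} (hS : S / 2 = 1) (ht : m * S = 12 * t) :
    (S : ℤ) ∈ F₁ m '' Z₁ m ↔ IsSquare t := by
  constructor
  · intro h
    obtain ⟨_, l, hl, h⟩ := exists_list_of_mem_image h
    obtain ⟨a, rfl⟩ := List.length_eq_one_iff.mp (hl.trans hS)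
    simp only [List.map_cons, List.map_nil, List.sum_cons, List.sum_nil] at h
    exact ⟨a, by rw [← sq]; omega⟩
  · rintro ⟨a, rfl⟩
    refine mem_image_of_list (l := [a]) (by omega) (by omega) (by simp [hS]) ?_
    simp [ht, sq]

/-- The values `S = 4` and `S = 5`. -/
theorem mem_image_iff_sq_add_sq {m S t : ℕ} (hS : S / 2 = 2) (ht : m * S = 12 * t) :
    (S : ℤ) ∈ F₁ m '' Z₁ m ↔ ∃ x y : ℕ, t = x ^ 2 + y ^ 2 := by
  constructor
  · intro h
    obtain ⟨_, l, hl, h⟩ := exists_list_of_mem_image h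
    obtain ⟨a, b, rfl⟩ := List.length_eq_two.mp (hl.trans hS)
    simp only [List.map_cons, List.map_nil, List.sum_cons, List.sum_nil] at h
    exact ⟨a, b, by omega⟩
  · rintro ⟨a, b, rfl⟩
    refine mem_image_of_list (l := [a, b]) (by omega) (by omega) (by simp [hS]) ?_
    simp [ht]

/-- The values `S = 6` and `S = 7`. -/
theorem mem_image_iff_not_isFourPowForm {m S t : ℕ} (hS : S / 2 = 3) (ht : m * S = 12 * t) :
    (S : ℤ) ∈ F₁ m '' Z₁ m ↔ ¬ IsFourPowForm t := by
  rw [← exists_three_squares_iff]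
  constructor
  · intro h
    obtain ⟨_, l, hl, h⟩ := exists_list_of_mem_image h
    obtain ⟨a, b, c, rfl⟩ := List.length_eq_three.mp (hl.trans hS)
    simp only [List.map_cons, List.map_nil, List.sum_cons, List.sum_nil] at h
    exact ⟨a, b, c, by omega⟩
  · rintro ⟨a, b, c, rfl⟩
    refine mem_image_of_list (l := [a, b, c]) (by omega) (by omega) (by simp [hS]) ?_
    simp [ht, add_assoc]

/-- From `S = 8` on, Lagrange's four-square theorem leaves only the divisibility condition. -/
theorem mem_image_of_dvd {m S : ℕ} (hS : 8 ≤ S) (hS12 : S ≤ 12) (h : 12 ∣ m * S) :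
    (S : ℤ) ∈ F₁ m '' Z₁ m := by
  obtain ⟨t, ht⟩ := h
  obtain ⟨a, b, c, d, rfl⟩ := Nat.sum_four_squares t
  refine mem_image_of_list (l := [a, b, c, d] ++ List.replicate (S / 2 - 4) 0)
    (by omega) hS12 ?_ ?_
  · rw [List.length_append, List.length_replicate]
    simp only [List.length_cons, List.length_nil]
    omega
  · simp [ht, add_assoc]

theorem evenExponents_iff {a : ℕ} (ha : 0 < a) :
    EvenExponents a ↔ ∃ x y : ℕ, a = x ^ 2 + y ^ 2 := by
  rw [Nat.eq_sq_add_sq_iff]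
  constructor
  · intro h q hq hq4
    rw [← Nat.factorization_def _ (Nat.prime_of_mem_primeFactors hq)]
    exact h q (Nat.prime_of_mem_primeFactors hq) (Nat.dvd_of_mem_primeFactors hq) hq4
  · intro h q hq hqa hq4
    rw [Nat.factorization_def _ hq]
    exact h q (Nat.mem_primeFactors.mpr ⟨hq, hqa, ha.ne'⟩) hq4

theorem isFourPowForm_four_mul_iff {a : ℕ} : IsFourPowForm (4 * a) ↔ IsFourPowForm a := by
  constructor
  · rintro ⟨_ | k, t, h⟩
    · omega
    · exact ⟨k, t, Nat.eq_of_mul_eq_mul_left (by norm_num : 0 < 4) (by rw [h]; ring)⟩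
  · rintro ⟨k, t, rfl⟩
    exact ⟨k + 1, t, by ring⟩

theorem isFourPowForm_iff_mod_eight {a : ℕ} (ha : a % 4 ≠ 0) : IsFourPowForm a ↔ a % 8 = 7 := by
  constructor
  · rintro ⟨_ | k, t, h⟩
    · omega
    · rw [pow_succ', mul_assoc] at h
      omega
  · intro h
    exact ⟨0, a / 8, by omega⟩

/-- Factors of `4` can be removed from `u`. If then `7 u ≡ 7 [MOD 8]`, the number `6 u` is `2`
modulo `4`, and hence not of the form. -/
theorem not_isFourPowForm_seven_mul {u : ℕ} (h : IsFourPowForm (6 * u)) :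
    ¬ IsFourPowForm (7 * u) := by
  induction u using Nat.strong_induction_on with
  | _ u ih =>
    by_cases h4 : u % 4 = 0
    · obtain ⟨v, rfl⟩ := Nat.dvd_of_mod_eq_zero h4
      rw [show 6 * (4 * v) = 4 * (6 * v) by ring, isFourPowForm_four_mul_iff] at h
      rw [show 7 * (4 * v) = 4 * (7 * v) by ring, isFourPowForm_four_mul_iff]
      refine ih v ?_ h
      rcases Nat.eq_zero_or_pos v with rfl | hv
      · obtain ⟨k, t, h⟩ := h
        have : 0 < 4 ^ k * (8 * t + 7) := by positivity
        omega
      · omega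
    · rw [isFourPowForm_iff_mod_eight (by omega)]
      intro h7
      rw [isFourPowForm_iff_mod_eight (by omega)] at h
      omega

theorem isSquare_four_mul_iff {a : ℕ} : IsSquare (4 * a) ↔ IsSquare a := by
  constructor
  · rintro ⟨b, hb⟩
    obtain ⟨c, rfl⟩ : 2 ∣ b := by
      have h2 : 2 ∣ b * b := ⟨2 * a, by linarith⟩
      exact (Nat.prime_two.dvd_mul.mp h2).elim id id
    exact ⟨c, by linarith⟩
  · rintro ⟨b, rfl⟩
    exact ⟨2 * b, by ring⟩

/-- If `2 u` and `3 u` were squares, their product `6 u ^ 2` would make `6` a square. -/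
theorem not_isSquare_three_mul {u : ℕ} (hu : 0 < u) (h : IsSquare (2 * u)) :
    ¬ IsSquare (3 * u) := by
  rintro ⟨b, hb⟩
  obtain ⟨a, ha⟩ := h
  have hsq : (2 * b) ^ 2 = a ^ 2 * 6 := by linarith
  obtain ⟨c, hc⟩ : a ∣ 2 * b := (Nat.pow_dvd_pow_iff two_ne_zero).mp ⟨6, hsq⟩
  have ha0 : 0 < a ^ 2 := by rw [sq]; omega
  have hc6 : c ^ 2 = 6 := by
    refine Nat.eq_of_mul_eq_mul_left ha0 ?_
    rw [← hsq, hc, mul_pow]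
  have : c < 3 := by nlinarith
  interval_cases c <;> omega

/-- The primes `2` and `5` are not `3` modulo `4`, so that both conditions are those on `u`. -/
theorem EvenExponents.four_mul_of_five_mul {u : ℕ} (hu : 0 < u) (h : EvenExponents (5 * u)) :
    EvenExponents (4 * u) := by
  have key {p c : ℕ} (hp : p.Prime) (hc : c ≠ 0) (hpc : ¬ p ∣ c) :
      (c * u).factorization p = u.factorization p := by
    rw [Nat.factorization_mul hc hu.ne', Finsupp.add_apply,
      Nat.factorization_eq_zero_of_not_dvd hpc, zero_add]
  intro p hp hpu hp4
  have h4 : ¬ p ∣ 4 := fun hd => by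
    have := Nat.le_of_dvd (by norm_num) hd
    unfold Nat.ModEq at hp4
    interval_cases p <;> omega
  have h5 : ¬ p ∣ 5 := fun hd => by
    have := (Nat.prime_dvd_prime_iff_eq hp Nat.prime_five).mp hd
    unfold Nat.ModEq at hp4
    omega
  rw [key hp (by norm_num) h4, ← key hp (by norm_num) h5]
  exact h p hp (((hp.dvd_mul.mp hpu).resolve_left h4).mul_left 5) hp4

/-! ### The minimum is attained -/

theorem isLeast_calB {m : ℕ} : IsLeast (F₁ m '' Z₁ m) (calB (2 * m)) := by
  have hbdd : BddBelow (F₁ m '' Z₁ m) := ⟨0, by rintro _ ⟨N, hN, rfl⟩; exact hN.2.1.le⟩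
  have hne : (F₁ m '' Z₁ m).Nonempty :=
    ⟨_, mem_image_of_dvd (S := 12) (by norm_num) le_rfl (dvd_mul_left 12 m)⟩
  rw [calB, Nat.mul_div_cancel_left m two_pos]
  exact ⟨Int.csInf_mem hne hbdd, fun x hx => csInf_le hbdd hx⟩

/-- Only those smaller values `s` have to be excluded that satisfy `1 < s` and `12 ∣ m * s`. -/
theorem calB_eq {m S : ℕ} (hm : 0 < m) (hS : (S : ℤ) ∈ F₁ m '' Z₁ m)
    (hlt : ∀ s, 1 < s → s < S → 12 ∣ m * s → (s : ℤ) ∉ F₁ m '' Z₁ m) : calB (2 * m) = S := by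
  refine isLeast_calB.unique ⟨hS, ?_⟩
  rintro x hx
  obtain ⟨N, hN, rfl⟩ := id hx
  by_contra! h
  have h0 := hN.2.1
  obtain ⟨s, hs⟩ := Int.eq_ofNat_of_zero_le h0.le
  rw [hs] at hx h h0
  rcases eq_or_ne s 1 with rfl | h1
  · exact one_notMem_image hm hx
  · exact hlt s (by omega) (by omega) (dvd_of_mem_image hx) hx

/-! ### The minimum according to `gcd m 12` -/

theorem mem_image_twelve (m : ℕ) : ((12 : ℕ) : ℤ) ∈ F₁ m '' Z₁ m :=
  mem_image_of_dvd (by norm_num) le_rfl (dvd_mul_left 12 m)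

theorem calB_of_gcd_eq_one {m : ℕ} (hm : 0 < m) (h : m.gcd 12 = 1) : calB (2 * m) = 12 := by
  refine calB_eq (S := 12) hm (mem_image_twelve m) fun s hs1 hs hd => ?_
  have := Nat.le_of_dvd (by omega) ((Nat.Coprime.symm h).dvd_of_dvd_mul_left hd)
  omega

theorem calB_of_gcd_eq_two {m : ℕ} (hm : 0 < m) (h : m.gcd 12 = 2) :
    (¬ 2 * m ≡ 28 [MOD 32] → calB (2 * m) = 6) ∧ (2 * m ≡ 28 [MOD 32] → calB (2 * m) = 12) := by
  have hmod : m % 12 = 2 ∨ m % 12 = 10 := by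
    rw [Nat.gcd_comm, Nat.gcd_rec] at h
    have : m % 12 < 12 := Nat.mod_lt _ (by norm_num)
    interval_cases m % 12 <;> simp_all
  have h6 : ((6 : ℕ) : ℤ) ∈ F₁ m '' Z₁ m ↔ ¬ 2 * m ≡ 28 [MOD 32] := by
    rw [mem_image_iff_not_isFourPowForm (t := m / 2) rfl (by omega),
      isFourPowForm_iff_mod_eight (by omega), Nat.ModEq]
    omega
  constructor
  · intro hn
    refine calB_eq (S := 6) hm (h6.mpr hn) fun s hs1 hs hd => ?_
    interval_cases s <;> omega
  · intro hn
    refine calB_eq (S := 12) hm (mem_image_twelve m) fun s hs1 hs hd => ?_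
    obtain rfl : s = 6 := by interval_cases s <;> omega
    exact fun h' => h6.mp h' hn

theorem calB_of_gcd_eq_three {m : ℕ} (hm : 0 < m) (h : m.gcd 12 = 3) :
    (EvenExponents (2 * m / 6) → calB (2 * m) = 4) ∧
    (¬ EvenExponents (2 * m / 6) → calB (2 * m) = 8) := by
  have hmod : m % 12 = 3 ∨ m % 12 = 9 := by
    rw [Nat.gcd_comm, Nat.gcd_rec] at h
    have : m % 12 < 12 := Nat.mod_lt _ (by norm_num)
    interval_cases m % 12 <;> simp_all
  have h4 : ((4 : ℕ) : ℤ) ∈ F₁ m '' Z₁ m ↔ EvenExponents (2 * m / 6) := by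
    rw [mem_image_iff_sq_add_sq (t := 2 * m / 6) rfl (by omega), evenExponents_iff (by omega)]
  constructor
  · intro hn
    refine calB_eq (S := 4) hm (h4.mpr hn) fun s hs1 hs hd => ?_
    interval_cases s <;> omega
  · intro hn
    refine calB_eq (S := 8) hm (mem_image_of_dvd (by norm_num) (by norm_num) (by omega))
      fun s hs1 hs hd => ?_
    obtain rfl : s = 4 := by interval_cases s <;> omega
    exact fun h' => hn (h4.mp h')

theorem calB_of_gcd_eq_four {m : ℕ} (hm : 0 < m) (h : m.gcd 12 = 4) :
    (IsSquare (2 * m / 2) → calB (2 * m) = 3) ∧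
    (¬ IsSquare (2 * m / 2) → ¬ IsFourPowForm (2 * m) → calB (2 * m) = 6) ∧
    (¬ IsSquare (2 * m / 2) → IsFourPowForm (2 * m) → calB (2 * m) = 9) := by
  obtain ⟨v, rfl⟩ : 4 ∣ m := h ▸ Nat.gcd_dvd_left m 12
  have hmod : v % 3 ≠ 0 := fun h0 => by
    have : 12 ∣ Nat.gcd (4 * v) 12 := Nat.dvd_gcd (by omega) dvd_rfl
    omega
  have h3 : ((3 : ℕ) : ℤ) ∈ F₁ (4 * v) '' Z₁ (4 * v) ↔ IsSquare (2 * (4 * v) / 2) := by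
    rw [mem_image_iff_isSquare (t := v) rfl (by omega), Nat.mul_div_cancel_left _ two_pos,
      isSquare_four_mul_iff]
  have h6 : ((6 : ℕ) : ℤ) ∈ F₁ (4 * v) '' Z₁ (4 * v) ↔ ¬ IsFourPowForm (2 * (4 * v)) := by
    rw [mem_image_iff_not_isFourPowForm (t := 2 * v) rfl (by omega), mul_left_comm,
      isFourPowForm_four_mul_iff]
  refine ⟨fun hn => ?_, fun hn hn' => ?_, fun hn hn' => ?_⟩
  · refine calB_eq (S := 3) hm (h3.mpr hn) fun s hs1 hs hd => ?_
    interval_cases s; omega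
  · refine calB_eq (S := 6) hm (h6.mpr hn') fun s hs1 hs hd => ?_
    obtain rfl : s = 3 := by interval_cases s <;> omega
    exact fun h' => hn (h3.mp h')
  · refine calB_eq (S := 9) hm (mem_image_of_dvd (by norm_num) (by norm_num) (by omega))
      fun s hs1 hs hd => ?_
    obtain rfl | rfl : s = 3 ∨ s = 6 := by interval_cases s <;> omega
    · exact fun h' => hn (h3.mp h')
    · exact fun h' => h6.mp h' hn'

theorem calB_of_gcd_eq_six {m : ℕ} (hm : 0 < m) (h : m.gcd 12 = 6) :
    (IsSquare (2 * m / 12) → calB (2 * m) = 2) ∧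
    (¬ IsSquare (2 * m / 12) → EvenExponents (2 * m / 6) → calB (2 * m) = 4) ∧
    (¬ IsSquare (2 * m / 12) → ¬ EvenExponents (2 * m / 6) → ¬ 2 * m ≡ 28 [MOD 32] →
      calB (2 * m) = 6) ∧
    (¬ IsSquare (2 * m / 12) → ¬ EvenExponents (2 * m / 6) → 2 * m ≡ 28 [MOD 32] →
      calB (2 * m) = 8) := by
  have hmod : m % 12 = 6 := by
    rw [Nat.gcd_comm, Nat.gcd_rec] at h
    have : m % 12 < 12 := Nat.mod_lt _ (by norm_num)
    interval_cases m % 12 <;> simp_all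
  have h2 : ((2 : ℕ) : ℤ) ∈ F₁ m '' Z₁ m ↔ IsSquare (2 * m / 12) :=
    mem_image_iff_isSquare rfl (by omega)
  have h4 : ((4 : ℕ) : ℤ) ∈ F₁ m '' Z₁ m ↔ EvenExponents (2 * m / 6) := by
    rw [mem_image_iff_sq_add_sq (t := 2 * m / 6) rfl (by omega), evenExponents_iff (by omega)]
  have h6 : ((6 : ℕ) : ℤ) ∈ F₁ m '' Z₁ m ↔ ¬ 2 * m ≡ 28 [MOD 32] := by
    rw [mem_image_iff_not_isFourPowForm (t := m / 2) rfl (by omega),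
      isFourPowForm_iff_mod_eight (by omega), Nat.ModEq]
    omega
  refine ⟨fun hn => ?_, fun hn hn' => ?_, fun hn hn' hn'' => ?_, fun hn hn' hn'' => ?_⟩
  · exact calB_eq (S := 2) hm (h2.mpr hn) fun s hs1 hs hd => by omega
  · refine calB_eq (S := 4) hm (h4.mpr hn') fun s hs1 hs hd => ?_
    obtain rfl : s = 2 := by interval_cases s <;> omega
    exact fun h' => hn (h2.mp h')
  · refine calB_eq (S := 6) hm (h6.mpr hn'') fun s hs1 hs hd => ?_
    obtain rfl | rfl : s = 2 ∨ s = 4 := by interval_cases s <;> omega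
    · exact fun h' => hn (h2.mp h')
    · exact fun h' => hn' (h4.mp h')
  · refine calB_eq (S := 8) hm (mem_image_of_dvd (by norm_num) (by norm_num) (by omega))
      fun s hs1 hs hd => ?_
    obtain rfl | rfl | rfl : s = 2 ∨ s = 4 ∨ s = 6 := by interval_cases s <;> omega
    · exact fun h' => hn (h2.mp h')
    · exact fun h' => hn' (h4.mp h')
    · exact fun h' => h6.mp h' hn''

theorem calB_of_gcd_eq_twelve {m : ℕ} (hm : 0 < m) (h : m.gcd 12 = 12) :
    (IsSquare (2 * m / 12) → calB (2 * m) = 2) ∧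
    (IsSquare (2 * m / 2) → calB (2 * m) = 3) ∧
    (¬ IsSquare (2 * m / 12) → ¬ IsSquare (2 * m / 2) → EvenExponents (2 * m / 6) →
      calB (2 * m) = 4) ∧
    (¬ IsSquare (2 * m / 12) → ¬ IsSquare (2 * m / 2) → ¬ EvenExponents (2 * m / 6) →
      ¬ IsFourPowForm (2 * m) → calB (2 * m) = 6) ∧
    (¬ IsSquare (2 * m / 12) → ¬ IsSquare (2 * m / 2) → ¬ EvenExponents (2 * m / 6) →
      IsFourPowForm (2 * m) → calB (2 * m) = 7) := by
  obtain ⟨u, rfl⟩ : 12 ∣ m := h ▸ Nat.gcd_dvd_left m 12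
  have hu : 0 < u := by omega
  rw [show 2 * (12 * u) / 12 = 2 * u by omega, show 2 * (12 * u) / 2 = 4 * (3 * u) by omega,
    show 2 * (12 * u) / 6 = 4 * u by omega, isSquare_four_mul_iff,
    show IsFourPowForm (2 * (12 * u)) ↔ IsFourPowForm (6 * u) by
      rw [← isFourPowForm_four_mul_iff (a := 6 * u)]; ring_nf]
  have h2 : ((2 : ℕ) : ℤ) ∈ F₁ (12 * u) '' Z₁ (12 * u) ↔ IsSquare (2 * u) :=
    mem_image_iff_isSquare rfl (by ring)
  have h3 : ((3 : ℕ) : ℤ) ∈ F₁ (12 * u) '' Z₁ (12 * u) ↔ IsSquare (3 * u) :=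
    mem_image_iff_isSquare rfl (by ring)
  have h4 : ((4 : ℕ) : ℤ) ∈ F₁ (12 * u) '' Z₁ (12 * u) ↔ EvenExponents (4 * u) := by
    rw [mem_image_iff_sq_add_sq (t := 4 * u) rfl (by ring), evenExponents_iff (by omega)]
  have h5 : ((5 : ℕ) : ℤ) ∈ F₁ (12 * u) '' Z₁ (12 * u) → EvenExponents (4 * u) := by
    rw [mem_image_iff_sq_add_sq (t := 5 * u) rfl (by ring), ← evenExponents_iff (by omega)]
    exact EvenExponents.four_mul_of_five_mul hu
  have h6 : ((6 : ℕ) : ℤ) ∈ F₁ (12 * u) '' Z₁ (12 * u) ↔ ¬ IsFourPowForm (6 * u) :=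
    mem_image_iff_not_isFourPowForm rfl (by ring)
  have h7 : ((7 : ℕ) : ℤ) ∈ F₁ (12 * u) '' Z₁ (12 * u) ↔ ¬ IsFourPowForm (7 * u) :=
    mem_image_iff_not_isFourPowForm rfl (by ring)
  refine ⟨fun hn => ?_, fun hn => ?_, fun hn2 hn3 hn => ?_, fun hn2 hn3 hn4 hn => ?_,
    fun hn2 hn3 hn4 hn => ?_⟩
  · exact calB_eq (S := 2) hm (h2.mpr hn) fun s hs1 hs hd => by omega
  · refine calB_eq (S := 3) hm (h3.mpr hn) fun s hs1 hs hd => ?_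
    obtain rfl : s = 2 := by omega
    exact fun h' => not_isSquare_three_mul hu (h2.mp h') hn
  · refine calB_eq (S := 4) hm (h4.mpr hn) fun s hs1 hs hd => ?_
    obtain rfl | rfl : s = 2 ∨ s = 3 := by omega
    · exact fun h' => hn2 (h2.mp h')
    · exact fun h' => hn3 (h3.mp h')
  · refine calB_eq (S := 6) hm (h6.mpr hn) fun s hs1 hs hd => ?_
    obtain rfl | rfl | rfl | rfl : s = 2 ∨ s = 3 ∨ s = 4 ∨ s = 5 := by omega
    · exact fun h' => hn2 (h2.mp h')
    · exact fun h' => hn3 (h3.mp h')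
    · exact fun h' => hn4 (h4.mp h')
    · exact fun h' => hn4 (h5 h')
  · refine calB_eq (S := 7) hm (h7.mpr (not_isFourPowForm_seven_mul hn)) fun s hs1 hs hd => ?_
    obtain rfl | rfl | rfl | rfl | rfl : s = 2 ∨ s = 3 ∨ s = 4 ∨ s = 5 ∨ s = 6 := by omega
    · exact fun h' => hn2 (h2.mp h')
    · exact fun h' => hn3 (h3.mp h')
    · exact fun h' => hn4 (h4.mp h')
    · exact fun h' => hn4 (h5 h')
    · exact fun h' => h6.mp h' hn

/-! ### The set of minima -/

theorem calB_mem_values {m : ℕ} (hm : 0 < m) :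
    calB (2 * m) ∈ ({2, 3, 4, 6, 7, 8, 9, 12} : Set ℤ) := by
  simp only [Set.mem_insert_iff, Set.mem_singleton_iff]
  have hr : m.gcd 12 = 1 ∨ m.gcd 12 = 2 ∨ m.gcd 12 = 3 ∨ m.gcd 12 = 4 ∨ m.gcd 12 = 6 ∨
      m.gcd 12 = 12 := by
    have hdvd := Nat.gcd_dvd_right m 12
    have hle := Nat.le_of_dvd (by norm_num) hdvd
    interval_cases m.gcd 12 <;> omega
  rcases hr with h | h | h | h | h | h
  · have := calB_of_gcd_eq_one hm h
    tauto
  · have := calB_of_gcd_eq_two hm h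
    tauto
  · have := calB_of_gcd_eq_three hm h
    tauto
  · have := calB_of_gcd_eq_four hm h
    tauto
  · have := calB_of_gcd_eq_six hm h
    tauto
  · have := calB_of_gcd_eq_twelve hm h
    tauto

theorem not_isSquare_of_lt_of_lt {a k : ℕ} (h₁ : k * k < a) (h₂ : a < (k + 1) * (k + 1)) :
    ¬ IsSquare a := by
  rintro ⟨b, rfl⟩
  have := Nat.mul_self_lt_mul_self_iff.mp h₁
  have := Nat.mul_self_lt_mul_self_iff.mp h₂
  omega

theorem not_evenExponents_of_factorization_three {a : ℕ} (h₁ : 3 ∣ a) (h₂ : ¬ 9 ∣ a) :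
    ¬ EvenExponents a := by
  intro h
  have heven := h 3 Nat.prime_three h₁ rfl
  have ha : a ≠ 0 := by rintro rfl; exact h₂ (dvd_zero 9)
  have h1 := (Nat.prime_three.dvd_iff_one_le_factorization ha).mp h₁
  have h2 : ¬ 2 ≤ a.factorization 3 := fun hle =>
    h₂ ((Nat.prime_three.pow_dvd_iff_le_factorization ha).mpr hle)
  rw [show a.factorization 3 = 1 by omega] at heven
  exact Nat.not_even_one heven

theorem image_calB :
    calB '' {n : ℕ | 0 < n ∧ Even n} = {2, 3, 4, 6, 7, 8, 9, 12} := by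
  apply Set.Subset.antisymm
  · rintro _ ⟨n, ⟨hn, m, rfl⟩, rfl⟩
    rw [← two_mul]
    exact calB_mem_values (by omega)
  · rintro x hx
    simp only [Set.mem_insert_iff, Set.mem_singleton_iff] at hx
    rcases hx with rfl | rfl | rfl | rfl | rfl | rfl | rfl | rfl
    · exact ⟨2 * 6, by decide, (calB_of_gcd_eq_six (by norm_num) (by norm_num)).1 ⟨1, rfl⟩⟩
    · exact ⟨2 * 4, by decide, (calB_of_gcd_eq_four (by norm_num) (by norm_num)).1 ⟨2, rfl⟩⟩
    · exact ⟨2 * 3, by decide, (calB_of_gcd_eq_three (by norm_num) (by norm_num)).1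
        ((evenExponents_iff (by norm_num)).mpr ⟨1, 0, rfl⟩)⟩
    · exact ⟨2 * 2, by decide, (calB_of_gcd_eq_two (by norm_num) (by norm_num)).1 (by decide)⟩
    -- `1008 = 4 ^ 2 * 63` has the excluded form, and `3` divides `1008 / 6 = 168` just
    -- once.
    · exact ⟨2 * 504, by decide,
        (calB_of_gcd_eq_twelve (by norm_num) (by norm_num)).2.2.2.2
        (not_isSquare_of_lt_of_lt (k := 9) (by norm_num) (by norm_num))
        (not_isSquare_of_lt_of_lt (k := 22) (by norm_num) (by norm_num))
        (not_evenExponents_of_factorization_three (by norm_num) (by norm_num)) ⟨2, 7, rfl⟩⟩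
    · exact ⟨2 * 9, by decide, (calB_of_gcd_eq_three (by norm_num) (by norm_num)).2
        (not_evenExponents_of_factorization_three (by norm_num) (by norm_num))⟩
    -- `112 = 4 ^ 2 * 7` has the excluded form.
    · exact ⟨2 * 56, by decide, (calB_of_gcd_eq_four (by norm_num) (by norm_num)).2.2
        (not_isSquare_of_lt_of_lt (k := 7) (by norm_num) (by norm_num)) ⟨2, 0, rfl⟩⟩
    · exact ⟨2 * 1, by decide, calB_of_gcd_eq_one (by norm_num) (by norm_num)⟩

theorem mainTheorem3 :
    (∀ n m : ℕ, 0 < n → n = 2 * m →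
      IsLeast (F₁ m '' Z₁ m) (calB n) ∧
      -- (i)
      (Nat.gcd m 12 = 1 → calB n = 12) ∧
      -- (ii)
      (Nat.gcd m 12 = 2 →
        (¬ n ≡ 28 [MOD 32] → calB n = 6) ∧
        (n ≡ 28 [MOD 32] → calB n = 12)) ∧
      -- (iii)
      (Nat.gcd m 12 = 3 →
        (EvenExponents (n / 6) → calB n = 4) ∧
        (¬ EvenExponents (n / 6) → calB n = 8)) ∧
      -- (iv)
      (Nat.gcd m 12 = 4 →
        (IsSquare (n / 2) → calB n = 3) ∧
        (¬ IsSquare (n / 2) → ¬ IsFourPowForm n → calB n = 6) ∧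
        (¬ IsSquare (n / 2) → IsFourPowForm n → calB n = 9)) ∧
      -- (v)
      (Nat.gcd m 12 = 6 →
        (IsSquare (n / 12) → calB n = 2) ∧
        (¬ IsSquare (n / 12) → EvenExponents (n / 6) → calB n = 4) ∧
        (¬ IsSquare (n / 12) → ¬ EvenExponents (n / 6) → ¬ n ≡ 28 [MOD 32] → calB n = 6) ∧
        (¬ IsSquare (n / 12) → ¬ EvenExponents (n / 6) → n ≡ 28 [MOD 32] → calB n = 8)) ∧
      -- (vi)
      (Nat.gcd m 12 = 12 →
        (IsSquare (n / 12) → calB n = 2) ∧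
        (IsSquare (n / 2) → calB n = 3) ∧
        (¬ IsSquare (n / 12) → ¬ IsSquare (n / 2) → EvenExponents (n / 6) → calB n = 4) ∧
        (¬ IsSquare (n / 12) → ¬ IsSquare (n / 2) → ¬ EvenExponents (n / 6) →
          ¬ IsFourPowForm n → calB n = 6) ∧
        (¬ IsSquare (n / 12) → ¬ IsSquare (n / 2) → ¬ EvenExponents (n / 6) →
          IsFourPowForm n → calB n = 7))) ∧
    -- the values taken by `calB` on the positive even integers
    calB '' {n : ℕ | 0 < n ∧ Even n} = {2, 3, 4, 6, 7, 8, 9, 12} := by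
  refine ⟨?_, image_calB⟩
  rintro n m hn rfl
  have hm : 0 < m := by omega
  exact ⟨isLeast_calB, calB_of_gcd_eq_one hm, calB_of_gcd_eq_two hm, calB_of_gcd_eq_three hm,
    calB_of_gcd_eq_four hm, calB_of_gcd_eq_six hm, calB_of_gcd_eq_twelve hm⟩
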